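/- Let $\lambda$ and $\mu$ be integer partitions with $\mu\subseteq\lambda$, identified with their Young diagrams, and let the skew diagram $\lambda/\mu$ (the boxes of $\lambda$ that are not in $\mu$) have size $n=|\lambda|-|\mu|$. A semistandard Young tableau of shape $\lambda/\mu$ is a filling of the boxes of $\lambda/\mu$ by positive integers that is weakly increasing along rows from left to right and strictly increasing down columns; ${\rm SSYT}(\lambda/\mu)$ denotes the set of these. Label the boxes of $\lambda/\mu$ by $1,\dots,n$ in any fixed way and write $c(T_i)$ for the entry of $T$ in the box labelled $i$. The Rosas-Sagan skew Schur function is the formal power series with rational coefficients in noncommuting variables $x_1,x_2,\dots$ $$S_{\lambda/\mu}=\sum_{\delta\in\mathfrak S_n}\ \sum_{T\in{\rm SSYT}(\lambda/\mu)}x_{c(T_{\delta(1)})}x_{c(T_{\delta(2)})}\cdots x_{c(T_{\delta(n)})},$$ and the Rosas-Sagan Schur function is $S_\nu=S_{\nu/\emptyset}$. For $\nu\vdash n$ let $c^\lambda_{\mu\nu}$ be the Littlewood-Richardson coefficient, that is, the (nonnegative) number of $T\in{\rm SSYT}(\lambda/\mu)$ that contain exactly $\nu_k$ entries equal to $k$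 for every $k\ge1$ (with $\nu_k=0$ beyond the length of $\nu$) and whose reverse reading word (rows from top to bottom, each row read from right to left) is a lattice word: for every $k\ge 1$, every initial segment of it contains at least as many letters $k$ as letters $k+1$. Then $S_{\lambda/\mu}$ is a positive (that is, nonnegative integer) sum of Rosas-Sagan Schur functions, namely $$S_{\lambda/\mu}=\sum_{\nu\vdash n}c^\lambda_{\mu\nu}\,S_\nu .$$ -/

import Mathlib

namespace NCSchur

/-- The boxes of the skew diagram `lam / mu` (used for `mu ≤ lam`): the boxes of the Young diagram
`lam` that do not belong to `mu`.  A box `(i, j)` lies in row `i` (counted from the top) and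
column `j` (counted from the left). -/
def skewCells (lam mu : YoungDiagram) : Finset (ℕ × ℕ) := lam.cells \ mu.cells

/-- Semistandard Young tableaux of shape `lam / mu`: fillings of the boxes by positive integers
that weakly increase along rows and strictly increase down columns. -/
@[ext]
structure SkewSSYT (lam mu : YoungDiagram) where
  entry : {b : ℕ × ℕ // b ∈ skewCells lam mu} → ℕ+
  row_weak : ∀ a b : {b : ℕ × ℕ // b ∈ skewCells lam mu},
    a.1.1 = b.1.1 → a.1.2 < b.1.2 → entry a ≤ entry b
  col_strict : ∀ a b : {b : ℕ × ℕ // b ∈ skewCells lam mu},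
    a.1.2 = b.1.2 → a.1.1 < b.1.1 → entry a < entry b

/-- Formal power series with rational coefficients in the noncommuting variables
`x_1, x_2, x_3, …`.  A monomial is a word, that is, an element of the free monoid on the set of
indices, and a series is the family of its coefficients.  Addition and scalar multiplication are
the coefficientwise ones. -/
abbrev NCSeries : Type := FreeMonoid ℕ+ → ℚ

/-- A fixed labelling `T_1, …, T_n` of the boxes of `lam / mu`. -/
noncomputable def boxLabel (lam mu : YoungDiagram) :
    Fin (skewCells lam mu).card ≃ {b : ℕ × ℕ // b ∈ skewCells lam mu} :=
  (skewCells lam mu).equivFin.symm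

/-- The monomial `x_{c(T_{δ(1)})} x_{c(T_{δ(2)})} ⋯ x_{c(T_{δ(n)})}`, where `c(T_i)` is the entry of
the tableau `T` in the box with label `i`. -/
noncomputable def tableauWord {lam mu : YoungDiagram}
    (δ : Equiv.Perm (Fin (skewCells lam mu).card)) (T : SkewSSYT lam mu) : FreeMonoid ℕ+ :=
  FreeMonoid.ofList (List.ofFn fun k => T.entry (boxLabel lam mu (δ k)))

/-- The Rosas-Sagan skew Schur function
`S_{lam/mu} = ∑_δ ∑_T x_{c(T_{δ(1)})} x_{c(T_{δ(2)})} ⋯ x_{c(T_{δ(n)})}`, the sum over all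
permutations `δ` of `{1, …, n}` and all semistandard tableaux `T` of shape `lam / mu`:
the coefficient of a word is the number of pairs `(δ, T)` that contribute it
(a finite number, see `finite_tableauWord_eq`). -/
noncomputable def rosasSaganSkew (lam mu : YoungDiagram) : NCSeries := fun w =>
  (Nat.card {p : Equiv.Perm (Fin (skewCells lam mu).card) × SkewSSYT lam mu //
    tableauWord p.1 p.2 = w} : ℚ)

/-- The Rosas-Sagan Schur function `S_nu = S_{nu/∅}`. -/
noncomputable def rosasSagan (nu : YoungDiagram) : NCSeries := rosasSaganSkew nu ⊥

/-- The tableau has content `nu`: for every `k ≥ 1`, the number of entries equal to `k` is the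
`k`-th part of `nu` (parts beyond the length of `nu` being zero). -/
def HasContent {lam mu : YoungDiagram} (T : SkewSSYT lam mu) (nu : YoungDiagram) : Prop :=
  ∀ k : ℕ+, (Finset.univ.filter fun b => T.entry b = k).card = nu.rowLen ((k : ℕ) - 1)

/-- `ReadBefore a b`: the box `a` is read no later than the box `b` when the rows are read from top
to bottom and each row is read from right to left. -/
def ReadBefore (a b : ℕ × ℕ) : Prop := a.1 < b.1 ∨ (a.1 = b.1 ∧ b.2 ≤ a.2)

instance (a b : ℕ × ℕ) : Decidable (ReadBefore a b) :=
  inferInstanceAs (Decidable (a.1 < b.1 ∨ (a.1 = b.1 ∧ b.2 ≤ a.2)))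

/-- The reverse reading word of `T` (rows from top to bottom, each row from right to left) is a
lattice word: every initial segment of it (the segment that ends in the box `b`) contains at least
as many letters `k` as letters `k + 1`, for every `k ≥ 1`. -/
def IsLattice {lam mu : YoungDiagram} (T : SkewSSYT lam mu) : Prop :=
  ∀ (b : {b : ℕ × ℕ // b ∈ skewCells lam mu}) (k : ℕ+),
    (Finset.univ.filter fun a : {b : ℕ × ℕ // b ∈ skewCells lam mu} =>
        ReadBefore a.1 b.1 ∧ T.entry a = k + 1).card ≤
      (Finset.univ.filter fun a : {b : ℕ × ℕ // b ∈ skewCells lam mu} =>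
        ReadBefore a.1 b.1 ∧ T.entry a = k).card

/-- The Littlewood-Richardson coefficient `c^lam_{mu nu}` (for `mu ≤ lam`): the number of
Littlewood-Richardson tableaux of shape `lam / mu` and content `nu`, that is, of semistandard
tableaux of that shape and content whose reverse reading word is a lattice word. -/
noncomputable def lrCoeff (lam mu nu : YoungDiagram) : ℕ :=
  Nat.card {T : SkewSSYT lam mu // HasContent T nu ∧ IsLattice T}

theorem finite_youngDiagram_card (n : ℕ) : {nu : YoungDiagram | nu.card = n}.Finite := by
  refine Set.Finite.of_finite_image (f := YoungDiagram.cells)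
    ((Finset.finite_toSet ((Finset.range n ×ˢ Finset.range n).powerset)).subset ?_)
    (fun a _ b _ h => YoungDiagram.ext h)
  rintro _ ⟨nu, hnu, rfl⟩
  simp only [Set.mem_ofPred_eq] at hnu
  simp only [Finset.coe_powerset, Set.mem_preimage, Set.mem_powerset_iff, Finset.coe_subset]
  rintro ⟨i, j⟩ hij
  have hij' : (i, j) ∈ nu := hij
  have h1 : nu.colLen j ≤ n := by
    rw [YoungDiagram.colLen_eq_card, ← hnu]
    exact Finset.card_le_card (Finset.filter_subset _ _)
  have h2 : nu.rowLen i ≤ n := by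
    rw [YoungDiagram.rowLen_eq_card, ← hnu]
    exact Finset.card_le_card (Finset.filter_subset _ _)
  have h3 := YoungDiagram.mem_iff_lt_colLen.1 hij'
  have h4 := YoungDiagram.mem_iff_lt_rowLen.1 hij'
  simp only [Finset.mem_product, Finset.mem_range]
  omega

/-- The finite set of all integer partitions `nu ⊢ n`, as Young diagrams with `n` boxes. -/
noncomputable def partitionsOf (n : ℕ) : Finset YoungDiagram :=
  (finite_youngDiagram_card n).toFinset

theorem mem_partitionsOf {n : ℕ} {nu : YoungDiagram} : nu ∈ partitionsOf n ↔ nu.card = n := by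
  simp [partitionsOf]

/-- Only finitely many pairs `(δ, T)` contribute a given word. -/
theorem finite_tableauWord_eq (lam mu : YoungDiagram) (w : FreeMonoid ℕ+) :
    Finite {p : Equiv.Perm (Fin (skewCells lam mu).card) × SkewSSYT lam mu //
      tableauWord p.1 p.2 = w} := by
  let F : {p : Equiv.Perm (Fin (skewCells lam mu).card) × SkewSSYT lam mu //
      tableauWord p.1 p.2 = w} → Equiv.Perm (Fin (skewCells lam mu).card) := fun p => p.1.1
  refine Finite.of_injective F ?_
  rintro ⟨⟨δ, T⟩, h⟩ ⟨⟨δ', T'⟩, h'⟩ hF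
  obtain rfl : δ = δ' := hF
  have h2 : tableauWord δ T = tableauWord δ T' := h.trans h'.symm
  have h3 := List.ofFn_injective (FreeMonoid.ofList.injective h2)
  have : T = T' := by
    ext1
    funext b
    have := congrFun h3 (δ.symm ((boxLabel lam mu).symm b))
    simpa using this
  subst this
  rfl

end NCSchur

/-!
The coefficient of a word `w` in a Rosas-Sagan skew function is the number of semistandard tableaux
with the content of `w`, times the number of permutations of the positions of `w` that fix it
(`rosasSaganSkew_apply`).  The second factor does not depend on the shape, so the theorem is the
Littlewood-Richardson rule for the commutative Schur polynomials, read off coefficient by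
coefficient in sufficiently many variables (`schurPoly_eq_sum`).

That rule is proved by Stembridge's sign-reversing involution.  Let `ρ` be the staircase and
`a_γ` the alternant with exponent `γ`.  Schur polynomials of skew shapes are symmetric, by the
Bender-Knuth involutions (`isSymmetric_schurPoly`); hence `a_ρ s` is the sum of
`a_{weight T + ρ}` over all tableaux `T` of the shape (`alternant_mul_schurPoly`).  Call `T` column
lattice if the content of the columns from `j` on is a partition, for every `j`.  If `T` is not
column lattice, take the largest `j` that fails and then the smallest `k` such that these columns
have more entries `k + 1` than `k`.  The Bender-Knuth involution for `k`, `k + 1` on the columns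
before `j` then gives a tableau with the same leading failure, and exchanges the exponents of
`weight T + ρ` at `k` and `k + 1`, which negates the alternant.  So
`a_ρ s = ∑ a_{weight T + ρ}` over the column lattice tableaux
(`alternant_staircase_mul_schurPoly`).

Column lattice tableaux are exactly those whose reverse reading word is a lattice word
(`isRowLattice_iff`), and a straight shape `ν` has a single one, of weight `ν`, so that
`a_ρ s_ν = a_{ν + ρ}` (`alternant_staircase_mul_schurPoly_cells`).  Grouping the sum for a skew
shape by weight and cancelling `a_ρ ≠ 0` gives the rule.
-/

namespace NCSchur

open Finset

variable {S : Finset (ℕ × ℕ)} {T : ℕ × ℕ → ℕ} {k j : ℕ}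

/-! ### Ranks in a finite set of natural numbers -/

/-- Refilling by rank puts exactly `b` entries `k` into a row: this is how the Bender-Knuth
involution exchanges multiplicities. -/
theorem filter_rank_lt_card (F : Finset ℕ) {b : ℕ} (hb : b ≤ #F) :
    #{c ∈ F | #{d ∈ F | d < c} < b} = b := by
  have hlt : ∀ c ∈ F, ∀ d ∈ F, c < d → #{e ∈ F | e < c} < #{e ∈ F | e < d} := by
    intro c hc d hd hcd
    refine card_lt_card ⟨fun e he => ?_, fun h => ?_⟩
    · simp only [mem_filter] at he ⊢
      exact ⟨he.1, he.2.trans hcd⟩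
    · have := h (mem_filter.2 ⟨hc, hcd⟩)
      simp at this
  have hinj : Set.InjOn (fun c => #{d ∈ F | d < c}) (F : Set ℕ) := by
    intro c hc d hd h
    rcases lt_trichotomy c d with h' | h' | h'
    · exact absurd h (hlt c hc d hd h').ne
    · exact h'
    · exact absurd h (hlt d hd c hc h').ne'
  have himg : F.image (fun c => #{d ∈ F | d < c}) = range #F := by
    refine eq_of_subset_of_card_le ?_ ?_
    · intro m hm
      obtain ⟨c, hc, rfl⟩ := mem_image.1 hm
      refine mem_range.2 (card_lt_card ⟨filter_subset _ _, fun h => ?_⟩)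
      have := h hc
      simp at this
    · rw [card_image_of_injOn hinj, card_range]
  calc #{c ∈ F | #{d ∈ F | d < c} < b}
      = #({c ∈ F | #{d ∈ F | d < c} < b}.image (fun c => #{d ∈ F | d < c})) :=
        (card_image_of_injOn (hinj.mono (by simp [Set.subset_def]; tauto))).symm
    _ = #(range b) := by
        congr 1
        ext m
        simp only [mem_image, mem_filter, mem_range]
        constructor
        · rintro ⟨c, ⟨-, h⟩, rfl⟩
          exact h
        · intro hm
          have : m ∈ F.image (fun c => #{d ∈ F | d < c}) := by
            rw [himg]
            exact mem_range.2 (hm.trans_le hb)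
          obtain ⟨c, hc, rfl⟩ := mem_image.1 this
          exact ⟨c, ⟨hc, hm⟩, rfl⟩
    _ = b := card_range b

/-- An initial part of `F` is recognized by rank.  Applied to the entries `k` of a row, it shows
that the Bender-Knuth map is an involution. -/
theorem rank_lt_card_iff {F : Finset ℕ} {p : ℕ → Prop} [DecidablePred p]
    (hp : ∀ c ∈ F, ∀ d ∈ F, c < d → p d → p c) {c : ℕ} (hc : c ∈ F) :
    #{d ∈ F | d < c} < #{d ∈ F | p d} ↔ p c := by
  constructor
  · intro h
    by_contra hpc
    refine absurd (card_le_card (fun d hd => ?_)) h.not_ge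
    simp only [mem_filter] at hd ⊢
    refine ⟨hd.1, lt_of_not_ge fun hle => hpc ?_⟩
    rcases hle.eq_or_lt with rfl | hlt
    · exact hd.2
    · exact hp c hc d hd.1 hlt hd.2
  · intro h
    refine card_lt_card ⟨fun d hd => ?_, fun hsub => ?_⟩
    · simp only [mem_filter] at hd ⊢
      exact ⟨hd.1, hp d hd.1 c hc hd.2 h⟩
    · have := hsub (mem_filter.2 ⟨hc, h⟩)
      simp at this

/-! ### Tableaux and the Bender-Knuth involution -/

/-- The filling `T` of the boxes in `S` weakly increases along rows, strictly increases down
columns, and is `0` off `S`.  Entries start at `0`, so that they index variables `x_0, x_1, …`. -/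
structure IsTableau (S : Finset (ℕ × ℕ)) (T : ℕ × ℕ → ℕ) : Prop where
  row : ∀ {r c c' : ℕ}, (r, c) ∈ S → (r, c') ∈ S → c ≤ c' → T (r, c) ≤ T (r, c')
  col : ∀ {r r' c : ℕ}, (r, c) ∈ S → (r', c) ∈ S → r < r' → T (r, c) < T (r', c)
  off : ∀ {x : ℕ × ℕ}, x ∉ S → T x = 0

theorem IsTableau.row_eq (hT : IsTableau S T) {r r' c : ℕ} (h : (r, c) ∈ S) (h' : (r', c) ∈ S)
    (he : T (r, c) = T (r', c)) : r = r' := by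
  rcases lt_trichotomy r r' with hr | hr | hr
  · exact absurd he (hT.col h h' hr).ne
  · exact hr
  · exact absurd he (hT.col h' h hr).ne'

/-- The rectangle property of a skew diagram, in coordinates. -/
theorem mem_of_corners (hS : (S : Set (ℕ × ℕ)).OrdConnected) {r r' c c' a b : ℕ}
    (h : (r, c) ∈ S) (h' : (r', c') ∈ S) (h1 : r ≤ a) (h2 : a ≤ r') (h3 : c ≤ b) (h4 : b ≤ c') :
    (a, b) ∈ S :=
  hS.out h h' ⟨⟨h1, h3⟩, ⟨h2, h4⟩⟩

/-- The box `x` of the columns before `j` is free for `k` in `T`: its entry is `k` or `k + 1`, and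
no other box of its column has such an entry.  These are the boxes that the Bender-Knuth
involution changes. -/
def IsFree (S : Finset (ℕ × ℕ)) (k j : ℕ) (T : ℕ × ℕ → ℕ) (x : ℕ × ℕ) : Prop :=
  x ∈ S ∧ x.2 < j ∧ (T x = k ∨ T x = k + 1) ∧
    ∀ r, (r, x.2) ∈ S → (T (r, x.2) = k ∨ T (r, x.2) = k + 1) → r = x.1

open Classical in
/-- The columns of the free boxes in row `r`. -/
noncomputable def freeCols (S : Finset (ℕ × ℕ)) (k j : ℕ) (T : ℕ × ℕ → ℕ) (r : ℕ) : Finset ℕ :=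
  {c ∈ S.image Prod.snd | IsFree S k j T (r, c)}

theorem mem_freeCols {r c : ℕ} : c ∈ freeCols S k j T r ↔ IsFree S k j T (r, c) := by
  classical
  simp only [freeCols, mem_filter, mem_image, and_iff_right_iff_imp]
  exact fun h => ⟨_, h.1, rfl⟩

open Classical in
/-- The Bender-Knuth involution for the entries `k` and `k + 1`, restricted to the columns before
`j`: if the free boxes of a row hold `a` entries `k` and then `b` entries `k + 1`, they are refilled
with `b` entries `k` and then `a` entries `k + 1`. -/
noncomputable def benderKnuth (S : Finset (ℕ × ℕ)) (k j : ℕ) (T : ℕ × ℕ → ℕ) (x : ℕ × ℕ) : ℕ :=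
  if IsFree S k j T x then
    if #{c ∈ freeCols S k j T x.1 | c < x.2} < #{c ∈ freeCols S k j T x.1 | T (x.1, c) = k + 1}
    then k else k + 1
  else T x

theorem benderKnuth_of_not_free {x : ℕ × ℕ} (h : ¬ IsFree S k j T x) :
    benderKnuth S k j T x = T x := if_neg h

theorem benderKnuth_mem_pair (x : ℕ × ℕ) :
    benderKnuth S k j T x = k ∨ benderKnuth S k j T x = k + 1 ↔ T x = k ∨ T x = k + 1 := by
  by_cases h : IsFree S k j T x
  · simp only [h.2.2.1, iff_true]
    rw [benderKnuth, if_pos h]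
    split_ifs <;> simp
  · rw [benderKnuth_of_not_free h]

theorem benderKnuth_of_not_pair {x : ℕ × ℕ} (h : ¬ (T x = k ∨ T x = k + 1)) :
    benderKnuth S k j T x = T x :=
  benderKnuth_of_not_free fun hf => h hf.2.2.1

theorem benderKnuth_of_le {x : ℕ × ℕ} (h : j ≤ x.2) : benderKnuth S k j T x = T x :=
  benderKnuth_of_not_free fun hf => absurd hf.2.1 h.not_gt

theorem benderKnuth_lt {N : ℕ} (hN : k + 1 < N) {x : ℕ × ℕ} (h : T x < N) :
    benderKnuth S k j T x < N := by
  by_cases hx : T x = k ∨ T x = k + 1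
  · have := (benderKnuth_mem_pair (S := S) (j := j) x).2 hx
    omega
  · rwa [benderKnuth_of_not_pair hx]

theorem isFree_benderKnuth (x : ℕ × ℕ) :
    IsFree S k j (benderKnuth S k j T) x ↔ IsFree S k j T x := by
  simp only [IsFree, benderKnuth_mem_pair]

theorem freeCols_benderKnuth (r : ℕ) :
    freeCols S k j (benderKnuth S k j T) r = freeCols S k j T r := by
  ext c
  rw [mem_freeCols, mem_freeCols, isFree_benderKnuth]

theorem benderKnuth_eq_iff {x : ℕ × ℕ} (h : IsFree S k j T x) :
    benderKnuth S k j T x = k ↔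
      #{c ∈ freeCols S k j T x.1 | c < x.2} < #{c ∈ freeCols S k j T x.1 | T (x.1, c) = k + 1} := by
  rw [benderKnuth, if_pos h]
  split_ifs with h' <;> simp [h']

theorem card_freeCols (r : ℕ) :
    #{c ∈ freeCols S k j T r | T (r, c) = k} + #{c ∈ freeCols S k j T r | T (r, c) = k + 1} =
      #(freeCols S k j T r) := by
  rw [← card_filter_add_card_filter_not (s := freeCols S k j T r) (fun c => T (r, c) = k)]
  congr 2
  refine filter_congr fun c hc => ?_
  have := (mem_freeCols.1 hc).2.2.1
  omega

theorem card_freeCols_benderKnuth (r : ℕ) :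
    #{c ∈ freeCols S k j T r | benderKnuth S k j T (r, c) = k} =
      #{c ∈ freeCols S k j T r | T (r, c) = k + 1} := by
  rw [← filter_rank_lt_card (freeCols S k j T r) (card_filter_le _ (fun c => T (r, c) = k + 1))]
  congr 1
  exact filter_congr fun c hc => benderKnuth_eq_iff (mem_freeCols.1 hc)

theorem card_freeCols_benderKnuth' (r : ℕ) :
    #{c ∈ freeCols S k j T r | benderKnuth S k j T (r, c) = k + 1} =
      #{c ∈ freeCols S k j T r | T (r, c) = k} := by
  have h1 := card_freeCols (S := S) (k := k) (j := j) (T := T) r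
  have h2 := card_freeCols (S := S) (k := k) (j := j) (T := benderKnuth S k j T) r
  rw [freeCols_benderKnuth, card_freeCols_benderKnuth] at h2
  omega

theorem benderKnuth_involutive (hT : IsTableau S T) :
    benderKnuth S k j (benderKnuth S k j T) = T := by
  funext x
  by_cases h : IsFree S k j T x
  · have h' := (isFree_benderKnuth x).2 h
    have h1 := benderKnuth_eq_iff h'
    rw [freeCols_benderKnuth, card_freeCols_benderKnuth',
      rank_lt_card_iff (p := fun c => T (x.1, c) = k) _ (mem_freeCols.2 h)] at h1
    · have h2 := h.2.2.1
      have h3 := (benderKnuth_mem_pair (S := S) (j := j) (T := benderKnuth S k j T) (k := k) x).2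
        ((benderKnuth_mem_pair x).2 h2)
      change _ ↔ T x = k at h1
      omega
    · intro c hc d hd hcd hdk
      have h2 := (mem_freeCols.1 hc).2.2.1
      have h3 := hT.row (mem_freeCols.1 hc).1 (mem_freeCols.1 hd).1 hcd.le
      omega
  · rw [benderKnuth_of_not_free (mt (isFree_benderKnuth x).1 h), benderKnuth_of_not_free h]

/-- The restricted Bender-Knuth involution preserves tableaux as soon as column `j` has no entry
`k`: this keeps the rows increasing where changed and unchanged columns meet. -/
theorem isTableau_benderKnuth (hS : (S : Set (ℕ × ℕ)).OrdConnected) (hT : IsTableau S T)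
    (hj : ∀ r, (r, j) ∈ S → T (r, j) ≠ k) : IsTableau S (benderKnuth S k j T) where
  off {x} hx := by
    rw [benderKnuth_of_not_free fun h => hx h.1, hT.off hx]
  col {r r' c} h h' hr := by
    have h1 := hT.col h h' hr
    by_cases hx : T (r, c) = k ∨ T (r, c) = k + 1
    · by_cases hy : T (r', c) = k ∨ T (r', c) = k + 1
      · rw [benderKnuth_of_not_free fun hf => hr.ne' (hf.2.2.2 r' h' hy),
          benderKnuth_of_not_free fun hf => hr.ne (hf.2.2.2 r h hx)]
        exact h1
      · rw [benderKnuth_of_not_pair hy]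
        have := (benderKnuth_mem_pair (S := S) (j := j) (r, c)).2 hx
        omega
    · rw [benderKnuth_of_not_pair hx]
      by_cases hy : T (r', c) = k ∨ T (r', c) = k + 1
      · have := (benderKnuth_mem_pair (S := S) (j := j) (r', c)).2 hy
        omega
      · rwa [benderKnuth_of_not_pair hy]
  row {r c c'} h h' hc := by
    have h1 := hT.row h h' hc
    rcases hc.eq_or_lt with rfl | hlt
    · exact le_rfl
    by_cases hx : T (r, c) = k ∨ T (r, c) = k + 1
    · have hx' := (benderKnuth_mem_pair (S := S) (j := j) (r, c)).2 hx
      by_cases hy : T (r, c') = k ∨ T (r, c') = k + 1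
      · have hy' := (benderKnuth_mem_pair (S := S) (j := j) (r, c')).2 hy
        by_cases fx : IsFree S k j T (r, c)
        · by_cases fy : IsFree S k j T (r, c')
          · suffices benderKnuth S k j T (r, c') = k → benderKnuth S k j T (r, c) = k by omega
            rw [benderKnuth_eq_iff fx, benderKnuth_eq_iff fy]
            refine lt_of_le_of_lt (card_le_card fun d hd => ?_)
            simp only [mem_filter] at hd ⊢
            exact ⟨hd.1, hd.2.trans hlt⟩
          · rw [benderKnuth_of_not_free fy]
            -- The free box `(r, c)` cannot lie left of an unchanged entry `k`.
            suffices T (r, c') ≠ k by omega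
            intro hk
            refine fy ⟨h', ?_, hy, fun r' hr' hp => ?_⟩
            · by_contra hge
              have hcj := fx.2.1
              simp only at hge hcj
              have hm := mem_of_corners hS h h' le_rfl le_rfl hcj.le (not_lt.1 hge)
              have h2 := hT.row h hm hcj.le
              have h3 := hT.row hm h' (not_lt.1 hge)
              exact hj r hm (by omega)
            · by_contra hne
              simp only at hr' hp hne
              have hrr : r < r' := by
                by_contra hle
                have := hT.col hr' h' (by omega)
                omega
              have hm := mem_of_corners hS h hr' hrr.le le_rfl le_rfl hlt.le
              have h2 := hT.col h hm hrr
              have h3 := hT.row hm hr' hlt.le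
              exact hrr.ne' (fx.2.2.2 r' hm (by simp only; omega))
        · rw [benderKnuth_of_not_free fx]
          by_cases fy : IsFree S k j T (r, c')
          · -- The free box `(r, c')` cannot lie right of an unchanged entry `k + 1`.
            suffices T (r, c) ≠ k + 1 by omega
            intro hk
            refine fx ⟨h, hlt.trans fy.2.1, hx, fun r' hr' hp => ?_⟩
            by_contra hne
            simp only at hr' hp hne
            have hrr : r' < r := by
              by_contra hle
              have := hT.col h hr' (by omega)
              omega
            have hm := mem_of_corners hS hr' h' le_rfl hrr.le hlt.le le_rfl
            have h2 := hT.col hm h' hrr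
            have h3 := hT.row hr' hm hlt.le
            exact hrr.ne (fy.2.2.2 r' hm (by simp only; omega))
          · rwa [benderKnuth_of_not_free fy]
      · rw [benderKnuth_of_not_pair hy]
        omega
    · rw [benderKnuth_of_not_pair hx]
      by_cases hy : T (r, c') = k ∨ T (r, c') = k + 1
      · have := (benderKnuth_mem_pair (S := S) (j := j) (r, c')).2 hy
        omega
      · rwa [benderKnuth_of_not_pair hy]

/-- A count of free boxes, row by row. -/
theorem card_isFree [DecidablePred (IsFree S k j T)] (p : ℕ × ℕ → Prop) [DecidablePred p] :
    #{x ∈ S | IsFree S k j T x ∧ p x} =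
      ∑ r ∈ S.image Prod.fst, #{c ∈ freeCols S k j T r | p (r, c)} := by
  rw [card_eq_sum_card_fiberwise (f := Prod.fst) (t := S.image Prod.fst)]
  · refine sum_congr rfl fun r _ => ?_
    refine card_nbij' Prod.snd (fun c => (r, c)) ?_ ?_ ?_ ?_
    · rintro ⟨a, c⟩ h
      simp only [coe_filter, mem_filter, Set.mem_ofPred_eq] at h
      obtain ⟨⟨-, h1, h2⟩, rfl⟩ := h
      simp only [coe_filter, Set.mem_ofPred_eq, mem_freeCols]
      exact ⟨h1, h2⟩
    · intro c h
      simp only [coe_filter, Set.mem_ofPred_eq, mem_freeCols] at h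
      simp only [coe_filter, mem_filter, Set.mem_ofPred_eq, and_true]
      exact ⟨h.1.1, h⟩
    · rintro ⟨a, c⟩ h
      simp only [coe_filter, mem_filter, Set.mem_ofPred_eq] at h
      rw [← h.2]
    · intro c _
      rfl
  · intro x hx
    simp only [coe_filter, Set.mem_ofPred_eq] at hx
    exact mem_coe.2 (mem_image_of_mem _ hx.1)

/-- Entries `k` and `k + 1` that are not free come in pairs, one above the other. -/
theorem card_not_isFree [DecidablePred (IsFree S k j T)] (hT : IsTableau S T) :
    #{x ∈ S | ¬ IsFree S k j T x ∧ x.2 < j ∧ T x = k} =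
      #{x ∈ S | ¬ IsFree S k j T x ∧ x.2 < j ∧ T x = k + 1} := by
  have key : ∀ a b, (a = k ∧ b = k + 1 ∨ a = k + 1 ∧ b = k) →
      ({x ∈ S | ¬ IsFree S k j T x ∧ x.2 < j ∧ T x = a}.image Prod.snd) ⊆
      ({x ∈ S | ¬ IsFree S k j T x ∧ x.2 < j ∧ T x = b}.image Prod.snd) := by
    intro a b hab c hc
    obtain ⟨⟨r, c'⟩, hx, rfl⟩ := mem_image.1 hc
    simp only [mem_filter] at hx
    obtain ⟨hxS, hnf, hxj, hxa⟩ := hx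
    have hxp : T (r, c') = k ∨ T (r, c') = k + 1 := by
      rcases hab with h | h <;> simp [hxa, h]
    obtain ⟨r', hr', hp, hne⟩ : ∃ r', (r', c') ∈ S ∧ (T (r', c') = k ∨ T (r', c') = k + 1) ∧
        r' ≠ r := by
      by_contra! hall
      exact hnf ⟨hxS, hxj, hxp, hall⟩
    have hval : T (r', c') = b := by
      have h1 : T (r', c') ≠ T (r, c') := fun h => hne (hT.row_eq hr' hxS h)
      omega
    refine mem_image.2 ⟨(r', c'), mem_filter.2 ⟨hr', fun hf => ?_, hxj, hval⟩, rfl⟩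
    exact hne (hf.2.2.2 r hxS (by simp only; omega)).symm
  have inj : ∀ a, Set.InjOn Prod.snd
      ({x ∈ S | ¬ IsFree S k j T x ∧ x.2 < j ∧ T x = a} : Set (ℕ × ℕ)) := by
    rintro a ⟨r, c⟩ hx ⟨r', c'⟩ hy (rfl : c = c')
    rw [hT.row_eq hx.1 hy.1 (hx.2.2.2.trans hy.2.2.2.symm)]
  have h := (key k (k + 1) (by simp)).antisymm (key (k + 1) k (by simp))
  have h' := congrArg card h
  rwa [card_image_of_injOn (by simpa using inj k),
    card_image_of_injOn (by simpa using inj (k + 1))] at h'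

/-! ### Weights and their change under the involution -/

/-- The number of entries `i` of `T` in the columns before `j`. -/
def countLT (S : Finset (ℕ × ℕ)) (T : ℕ × ℕ → ℕ) (j i : ℕ) : ℕ := #{x ∈ S | x.2 < j ∧ T x = i}

/-- The number of entries `i` of `T` in the columns from `j` on. -/
def countGE (S : Finset (ℕ × ℕ)) (T : ℕ × ℕ → ℕ) (j i : ℕ) : ℕ := #{x ∈ S | j ≤ x.2 ∧ T x = i}

/-- The number of entries `i` of `T`. -/
def weight (S : Finset (ℕ × ℕ)) (T : ℕ × ℕ → ℕ) (i : ℕ) : ℕ := #{x ∈ S | T x = i}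

theorem countLT_add_countGE (S : Finset (ℕ × ℕ)) (T : ℕ × ℕ → ℕ) (j i : ℕ) :
    countLT S T j i + countGE S T j i = weight S T i := by
  rw [weight, ← card_filter_add_card_filter_not (s := {x ∈ S | T x = i}) (fun x => x.2 < j),
    filter_filter, filter_filter]
  simp only [countLT, countGE, not_lt, and_comm]

theorem countGE_benderKnuth {j' : ℕ} (h : j ≤ j') (i : ℕ) :
    countGE S (benderKnuth S k j T) j' i = countGE S T j' i := by
  unfold countGE
  congr 1
  refine filter_congr fun x _ => and_congr_right fun hx => ?_
  rw [benderKnuth_of_le (h.trans hx)]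

theorem countLT_eq_add [DecidablePred (IsFree S k j T)] (T' : ℕ × ℕ → ℕ) (i : ℕ) :
    countLT S T' j i = #{x ∈ S | IsFree S k j T x ∧ T' x = i} +
      #{x ∈ S | ¬ IsFree S k j T x ∧ x.2 < j ∧ T' x = i} := by
  rw [countLT, ← card_filter_add_card_filter_not (s := {x ∈ S | x.2 < j ∧ T' x = i})
    (IsFree S k j T), filter_filter, filter_filter]
  congr 2
  · refine filter_congr fun x _ => ⟨fun h => ⟨h.2, h.1.2⟩, fun h => ⟨⟨h.1.2.1, h.2⟩, h.1⟩⟩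
  · refine filter_congr fun x _ => and_comm

theorem countLT_benderKnuth (hT : IsTableau S T) (i : ℕ) :
    countLT S (benderKnuth S k j T) j i = countLT S T j (Equiv.swap k (k + 1) i) := by
  classical
  have hnf : ∀ i, #{x ∈ S | ¬ IsFree S k j T x ∧ x.2 < j ∧ benderKnuth S k j T x = i} =
      #{x ∈ S | ¬ IsFree S k j T x ∧ x.2 < j ∧ T x = i} := by
    intro i
    congr 1
    refine filter_congr fun x _ => and_congr_right fun hx => ?_
    rw [benderKnuth_of_not_free hx]
  have hp := card_not_isFree (k := k) (j := j) hT
  rw [countLT_eq_add (k := k) (T := T), countLT_eq_add (k := k) (T := T), hnf]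
  by_cases h1 : i = k
  · subst h1
    rw [Equiv.swap_apply_left, hp, card_isFree, card_isFree]
    congr 1
    exact sum_congr rfl fun r _ => card_freeCols_benderKnuth r
  by_cases h2 : i = k + 1
  · subst h2
    rw [Equiv.swap_apply_right, hp, card_isFree, card_isFree]
    congr 1
    exact sum_congr rfl fun r _ => card_freeCols_benderKnuth' r
  rw [Equiv.swap_apply_of_ne_of_ne h1 h2]
  congr 2
  refine filter_congr fun x _ => and_congr_right fun hx => ?_
  have := hx.2.2.1
  have := (benderKnuth_mem_pair (S := S) (j := j) (T := T) (k := k) x).2 this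
  omega

/-! ### Schur polynomials and their symmetry -/

theorem finite_tableaux (S : Finset (ℕ × ℕ)) (N : ℕ) :
    {T : ℕ × ℕ → ℕ | IsTableau S T ∧ ∀ x ∈ S, T x < N}.Finite := by
  let F : {T : ℕ × ℕ → ℕ | IsTableau S T ∧ ∀ x ∈ S, T x < N} → S → Fin N :=
    fun T x => ⟨T.1 x.1, T.2.2 x.1 x.2⟩
  refine Set.finite_coe_iff.1 (Finite.of_injective F fun T T' h => Subtype.ext (funext fun x => ?_))
  by_cases hx : x ∈ S
  · exact congrArg Fin.val (congrFun h ⟨x, hx⟩)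
  · rw [T.2.1.off hx, T'.2.1.off hx]

/-- The tableaux on `S` with entries in `{0, …, N - 1}`. -/
noncomputable def tableaux (S : Finset (ℕ × ℕ)) (N : ℕ) : Finset (ℕ × ℕ → ℕ) :=
  (finite_tableaux S N).toFinset

theorem mem_tableaux {N : ℕ} : T ∈ tableaux S N ↔ IsTableau S T ∧ ∀ x ∈ S, T x < N := by
  simp [tableaux]

theorem benderKnuth_mem_tableaux {N : ℕ} (hS : (S : Set (ℕ × ℕ)).OrdConnected) (hk : k + 1 < N)
    (hT : T ∈ tableaux S N) (hj : ∀ r, (r, j) ∈ S → T (r, j) ≠ k) :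
    benderKnuth S k j T ∈ tableaux S N := by
  rw [mem_tableaux] at hT ⊢
  exact ⟨isTableau_benderKnuth hS hT.1 hj, fun x hx => benderKnuth_lt hk (hT.2 x hx)⟩

open MvPolynomial

/-- The Schur polynomial of `S` in the variables `x_0, …, x_{N-1}`. -/
noncomputable def schurPoly (S : Finset (ℕ × ℕ)) (N : ℕ) : MvPolynomial (Fin N) ℤ :=
  ∑ T ∈ tableaux S N, ∏ i : Fin N, X i ^ weight S T i

theorem weight_benderKnuth (hT : IsTableau S T) (hj : ∀ x ∈ S, x.2 < j) (i : ℕ) :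
    weight S (benderKnuth S k j T) i = weight S T (Equiv.swap k (k + 1) i) := by
  have h : ∀ T' i, weight S T' i = countLT S T' j i := by
    intro T' i
    unfold weight countLT
    congr 1
    exact filter_congr fun x hx => by simp [hj x hx]
  rw [h, h, countLT_benderKnuth hT]

theorem val_swap_castSucc_succ {m : ℕ} (a : Fin m) (i : Fin (m + 1)) :
    ((Equiv.swap a.castSucc a.succ i : Fin (m + 1)) : ℕ) =
      Equiv.swap (a : ℕ) (a + 1) i := by
  have := Fin.val_injective.swap_apply a.castSucc a.succ i
  simpa using this.symm

theorem rename_swap_schurPoly {m : ℕ} (hS : (S : Set (ℕ × ℕ)).OrdConnected) (a : Fin m) :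
    rename (Equiv.swap a.castSucc a.succ) (schurPoly S (m + 1)) = schurPoly S (m + 1) := by
  obtain ⟨j, hj⟩ : ∃ j, ∀ x ∈ S, x.2 < j :=
    ⟨S.sup Prod.snd + 1, fun x hx => Nat.lt_succ_of_le (le_sup (f := Prod.snd) hx)⟩
  have hmem : ∀ T ∈ tableaux S (m + 1), benderKnuth S a j T ∈ tableaux S (m + 1) := fun T hT =>
    benderKnuth_mem_tableaux hS (by omega) hT fun r hr => absurd (hj _ hr) (lt_irrefl j)
  rw [schurPoly, map_sum]
  refine sum_nbij' (benderKnuth S a j) (benderKnuth S a j) hmem hmem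
    (fun T hT => benderKnuth_involutive (mem_tableaux.1 hT).1)
    (fun T hT => benderKnuth_involutive (mem_tableaux.1 hT).1) fun T hT => ?_
  simp only [map_prod, map_pow, rename_X]
  rw [← Equiv.prod_comp (Equiv.swap a.castSucc a.succ)]
  refine prod_congr rfl fun i _ => ?_
  rw [Equiv.swap_apply_self, weight_benderKnuth (mem_tableaux.1 hT).1 hj,
    val_swap_castSucc_succ]

/-- Schur polynomials are symmetric: the Bender-Knuth involutions realize the adjacent
transpositions. -/
theorem isSymmetric_schurPoly (hS : (S : Set (ℕ × ℕ)).OrdConnected) (N : ℕ) :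
    (schurPoly S N).IsSymmetric := by
  rcases N with _ | m
  · intro e
    rw [Subsingleton.elim e (Equiv.refl _)]
    simp
  intro e
  have he : e ∈ Submonoid.closure
      (Set.range fun i : Fin m => Equiv.swap i.castSucc i.succ) := by
    rw [Equiv.Perm.mclosure_swap_castSucc_succ]
    trivial
  induction he using Submonoid.closure_induction with
  | mem x hx =>
    obtain ⟨a, rfl⟩ := hx
    exact rename_swap_schurPoly hS a
  | one => simp
  | mul x y _ _ hx hy =>
    rw [Equiv.Perm.coe_mul, ← rename_rename, hy, hx]

/-! ### Alternants -/

/-- The alternant `a_γ = ∑_σ sgn(σ) ∏_i x_{σ(i)}^{γ_i}`. -/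
noncomputable def alternant {N : ℕ} (γ : Fin N → ℕ) : MvPolynomial (Fin N) ℤ :=
  Matrix.det (Matrix.of fun i l : Fin N => (X i : MvPolynomial (Fin N) ℤ) ^ γ l)

theorem alternant_eq_sum {N : ℕ} (γ : Fin N → ℕ) :
    alternant γ = ∑ σ : Equiv.Perm (Fin N), Equiv.Perm.sign σ • ∏ i, X (σ i) ^ γ i := by
  simp only [alternant, Matrix.det_apply, Matrix.of_apply]

theorem alternant_comp_perm {N : ℕ} (γ : Fin N → ℕ) (σ : Equiv.Perm (Fin N)) :
    alternant (γ ∘ σ) = Equiv.Perm.sign σ * alternant γ :=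
  Matrix.det_permute' σ (Matrix.of fun i l : Fin N => (X i : MvPolynomial (Fin N) ℤ) ^ γ l)

/-- The staircase exponent `(N - 1, N - 2, …, 0)`. -/
def staircase (N : ℕ) (i : Fin N) : ℕ := N - 1 - i

theorem alternant_staircase_ne_zero (N : ℕ) : alternant (staircase N) ≠ 0 := by
  have h : staircase N = (fun i : Fin N => (i : ℕ)) ∘ Fin.revPerm := by
    funext i
    simp only [staircase, Function.comp, Fin.revPerm_apply, Fin.val_rev]
    omega
  rw [h, alternant_comp_perm]
  refine mul_ne_zero (by simp) ?_
  exact Matrix.det_vandermonde_ne_zero_iff.2 (X_injective (R := ℤ))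

theorem alternant_mul_schurPoly (hS : (S : Set (ℕ × ℕ)).OrdConnected) {N : ℕ} (γ : Fin N → ℕ) :
    alternant γ * schurPoly S N =
      ∑ T ∈ tableaux S N, alternant (fun i => weight S T i + γ i) := by
  have h : ∀ σ : Equiv.Perm (Fin N), schurPoly S N =
      ∑ T ∈ tableaux S N, ∏ i : Fin N, X (σ i) ^ weight S T i := by
    intro σ
    conv_lhs => rw [← isSymmetric_schurPoly hS N σ, schurPoly]
    simp only [map_sum, map_prod, map_pow, rename_X]
  simp only [alternant_eq_sum]
  rw [sum_comm, sum_mul]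
  refine sum_congr rfl fun σ _ => ?_
  conv_lhs => rw [h σ]
  rw [smul_mul_assoc, mul_sum, smul_sum]
  refine sum_congr rfl fun T _ => ?_
  rw [← prod_mul_distrib]
  congr 1
  refine prod_congr rfl fun i _ => ?_
  rw [pow_add, mul_comm]

/-! ### Cancellation of the tableaux that are not column lattice -/

/-- In every final segment of columns, `T` has at least as many entries `k` as entries `k + 1`:
the contents of these segments are partitions. -/
def IsColumnLattice (S : Finset (ℕ × ℕ)) (T : ℕ × ℕ → ℕ) : Prop :=
  ∀ j k, countGE S T j (k + 1) ≤ countGE S T j k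

/-- `(j, k)` is the leading failure of `IsColumnLattice`: the largest possible `j`, then the
smallest possible `k`. -/
def IsLeadingFailure (S : Finset (ℕ × ℕ)) (T : ℕ × ℕ → ℕ) (j k : ℕ) : Prop :=
  countGE S T j k < countGE S T j (k + 1) ∧
    (∀ j', j < j' → ∀ k', countGE S T j' (k' + 1) ≤ countGE S T j' k') ∧
    ∀ k', k' < k → countGE S T j (k' + 1) ≤ countGE S T j k'

theorem IsLeadingFailure.unique {j' k' : ℕ} (h : IsLeadingFailure S T j k)
    (h' : IsLeadingFailure S T j' k') : j' = j ∧ k' = k := by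
  have hj : j' = j := by
    rcases lt_trichotomy j j' with hlt | he | hlt
    · exact absurd h'.1 (h.2.1 _ hlt _).not_gt
    · exact he.symm
    · exact absurd h.1 (h'.2.1 _ hlt _).not_gt
  subst hj
  refine ⟨rfl, ?_⟩
  rcases lt_trichotomy k k' with hlt | he | hlt
  · exact absurd h.1 (h'.2.2 _ hlt).not_gt
  · exact he.symm
  · exact absurd h'.1 (h.2.2 _ hlt).not_gt

theorem exists_isLeadingFailure (h : ¬ IsColumnLattice S T) :
    ∃ j k, IsLeadingFailure S T j k := by
  classical
  simp only [IsColumnLattice, not_forall, not_le] at h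
  obtain ⟨j₀, hj₀⟩ := h
  have hbound : ∀ j, (∃ k, countGE S T j k < countGE S T j (k + 1)) → j ≤ S.sup Prod.snd := by
    rintro j ⟨k, hk⟩
    obtain ⟨x, hx⟩ := card_pos.1 ((Nat.zero_le _).trans_lt hk)
    rw [mem_filter] at hx
    exact hx.2.1.trans (le_sup (f := Prod.snd) hx.1)
  have hj := Nat.findGreatest_spec (P := fun j => ∃ k, countGE S T j k < countGE S T j (k + 1))
    (hbound j₀ hj₀) hj₀
  refine ⟨_, Nat.find hj, Nat.find_spec hj, fun j' hj' k' => ?_, fun k' hk' => ?_⟩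
  · by_contra hlt
    have hP : ∃ k, countGE S T j' k < countGE S T j' (k + 1) := ⟨k', not_le.1 hlt⟩
    exact hj'.not_ge (Nat.le_findGreatest (hbound j' hP) hP)
  · exact not_lt.1 (Nat.find_min hj hk')

theorem countGE_eq_add (S : Finset (ℕ × ℕ)) (T : ℕ × ℕ → ℕ) (j i : ℕ) :
    countGE S T j i = #{x ∈ S | x.2 = j ∧ T x = i} + countGE S T (j + 1) i := by
  rw [countGE, ← card_filter_add_card_filter_not (s := {x ∈ S | j ≤ x.2 ∧ T x = i})
    (fun x => x.2 = j), filter_filter, filter_filter, countGE]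
  congr 2
  · exact filter_congr fun x _ => by omega
  · exact filter_congr fun x _ => by omega

theorem IsTableau.card_column_le_one (hT : IsTableau S T) (j i : ℕ) :
    #{x ∈ S | x.2 = j ∧ T x = i} ≤ 1 := by
  refine card_le_one.2 ?_
  rintro ⟨r, c⟩ hx ⟨r', c'⟩ hy
  simp only [mem_filter] at hx hy
  obtain ⟨hx, rfl, hxi⟩ := hx
  obtain ⟨hy, rfl, hyi⟩ := hy
  rw [hT.row_eq hx hy (hxi.trans hyi.symm)]

/-- At the leading failure `(j, k)` the failure is by one, and column `j` has no entry `k`. -/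
theorem IsLeadingFailure.column (hT : IsTableau S T) (h : IsLeadingFailure S T j k) :
    countGE S T j (k + 1) = countGE S T j k + 1 ∧ ∀ r, (r, j) ∈ S → T (r, j) ≠ k := by
  have h1 := h.1
  have h2 := h.2.1 (j + 1) (Nat.lt_succ_self j) k
  have h3 := hT.card_column_le_one j (k + 1)
  have e1 := countGE_eq_add S T j k
  have e2 := countGE_eq_add S T j (k + 1)
  have h0 : #{x ∈ S | x.2 = j ∧ T x = k} = 0 := by omega
  refine ⟨by omega, fun r hr hk => ?_⟩
  exact (filter_eq_empty_iff.1 (card_eq_zero.1 h0) hr) ⟨rfl, hk⟩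

theorem IsLeadingFailure.benderKnuth (h : IsLeadingFailure S T j k) :
    IsLeadingFailure S (benderKnuth S k j T) j k := by
  refine ⟨?_, fun j' hj' k' => ?_, fun k' hk' => ?_⟩
  · rw [countGE_benderKnuth le_rfl, countGE_benderKnuth le_rfl]
    exact h.1
  · rw [countGE_benderKnuth hj'.le, countGE_benderKnuth hj'.le]
    exact h.2.1 j' hj' k'
  · rw [countGE_benderKnuth le_rfl, countGE_benderKnuth le_rfl]
    exact h.2.2 k' hk'

theorem IsLeadingFailure.not_isColumnLattice (h : IsLeadingFailure S T j k) :
    ¬ IsColumnLattice S T := fun h' => (h' j k).not_gt h.1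

theorem IsLeadingFailure.lt {N : ℕ} (h : IsLeadingFailure S T j k) (hT : T ∈ tableaux S N) :
    k + 1 < N := by
  obtain ⟨x, hx⟩ := card_pos.1 ((Nat.zero_le _).trans_lt h.1)
  rw [mem_filter] at hx
  rw [← hx.2.2]
  exact (mem_tableaux.1 hT).2 x hx.1

/-- The involution at the leading failure exchanges two exponents of the alternant: the columns from
`j` on contribute exponents at `k` and `k + 1` that become equal once the staircase is added. -/
theorem IsLeadingFailure.alternant_benderKnuth {N : ℕ} (hT : T ∈ tableaux S N)
    (h : IsLeadingFailure S T j k) :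
    alternant (fun i => weight S (NCSchur.benderKnuth S k j T) i + staircase N i) =
      - alternant (fun i => weight S T i + staircase N i) := by
  have hk := h.lt hT
  have hc := (h.column (mem_tableaux.1 hT).1).1
  have hk' : k < N := by omega
  set a : Fin N := ⟨k, hk'⟩ with ha
  set b : Fin N := ⟨k + 1, hk⟩ with hb
  have hab : a ≠ b := by simp [ha, hb]
  have key : (fun i : Fin N => weight S (NCSchur.benderKnuth S k j T) i + staircase N i) =
      (fun i : Fin N => weight S T i + staircase N i) ∘ Equiv.swap a b := by
    funext i
    have hw : ∀ i, weight S (NCSchur.benderKnuth S k j T) i =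
        countLT S T j (Equiv.swap k (k + 1) i) + countGE S T j i := by
      intro i
      rw [← countLT_add_countGE _ _ j, countLT_benderKnuth (mem_tableaux.1 hT).1,
        countGE_benderKnuth le_rfl]
    rw [hw]
    simp only [Function.comp]
    rw [← countLT_add_countGE S T j]
    rcases eq_or_ne i a with rfl | hia
    · simp only [Equiv.swap_apply_left, ha, hb, staircase, hc]
      omega
    rcases eq_or_ne i b with rfl | hib
    · simp only [Equiv.swap_apply_right, ha, hb, staircase, hc]
      omega
    rw [Equiv.swap_apply_of_ne_of_ne hia hib, Equiv.swap_apply_of_ne_of_ne]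
    · exact fun h => hia (Fin.ext h)
    · exact fun h => hib (Fin.ext h)
  rw [key, alternant_comp_perm, Equiv.Perm.sign_swap hab]
  simp

/-- The tableaux that are not column lattice cancel in pairs. -/
theorem sum_alternant_not_isColumnLattice [DecidablePred (IsColumnLattice S)]
    (hS : (S : Set (ℕ × ℕ)).OrdConnected) (N : ℕ) :
    ∑ T ∈ tableaux S N with ¬ IsColumnLattice S T,
      alternant (fun i : Fin N => weight S T i + staircase N i) = 0 := by
  classical
  have hex : ∀ T ∈ {T ∈ tableaux S N | ¬ IsColumnLattice S T},
      ∃ j k, IsLeadingFailure S T j k := fun T hT =>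
    exists_isLeadingFailure (mem_filter.1 hT).2
  choose! J K hJK using hex
  refine sum_involution (fun T _ => benderKnuth S (K T) (J T) T) ?_ ?_ ?_ ?_
  · intro T hT
    rw [(hJK T hT).alternant_benderKnuth (mem_filter.1 hT).1, add_neg_cancel]
  · intro T hT hne he
    have h := (hJK T hT).alternant_benderKnuth (mem_filter.1 hT).1
    rw [he] at h
    exact hne (self_eq_neg.1 h)
  · intro T hT
    have hT' := (mem_filter.1 hT).1
    exact mem_filter.2 ⟨benderKnuth_mem_tableaux hS ((hJK T hT).lt hT') hT'
      ((hJK T hT).column (mem_tableaux.1 hT').1).2,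
      (hJK T hT).benderKnuth.not_isColumnLattice⟩
  · intro T hT
    have hT' := (mem_filter.1 hT).1
    have hm : benderKnuth S (K T) (J T) T ∈ {T ∈ tableaux S N | ¬ IsColumnLattice S T} :=
      mem_filter.2 ⟨benderKnuth_mem_tableaux hS ((hJK T hT).lt hT') hT'
        ((hJK T hT).column (mem_tableaux.1 hT').1).2,
        (hJK T hT).benderKnuth.not_isColumnLattice⟩
    obtain ⟨h1, h2⟩ := (hJK T hT).benderKnuth.unique (hJK _ hm)
    rw [h1, h2, benderKnuth_involutive (mem_tableaux.1 hT').1]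

theorem alternant_staircase_mul_schurPoly [DecidablePred (IsColumnLattice S)]
    (hS : (S : Set (ℕ × ℕ)).OrdConnected) (N : ℕ) :
    alternant (staircase N) * schurPoly S N = ∑ T ∈ tableaux S N with IsColumnLattice S T,
      alternant (fun i : Fin N => weight S T i + staircase N i) := by
  rw [alternant_mul_schurPoly hS, ← sum_filter_add_sum_filter_not _ (IsColumnLattice S),
    sum_alternant_not_isColumnLattice hS, add_zero]

/-! ### Row reading and column reading -/

theorem ReadBefore.trans {a b c : ℕ × ℕ} (h : ReadBefore a b) (h' : ReadBefore b c) :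
    ReadBefore a c := by
  unfold ReadBefore at *
  omega

theorem exists_last_readBefore {A : Finset (ℕ × ℕ)} (hA : A.Nonempty) :
    ∃ x ∈ A, ∀ a ∈ A, ReadBefore a x := by
  obtain ⟨y, hy, hmax⟩ := exists_max_image A Prod.fst hA
  obtain ⟨x, hx, hmin⟩ := exists_min_image {a ∈ A | a.1 = y.1} Prod.snd
    ⟨y, mem_filter.2 ⟨hy, rfl⟩⟩
  rw [mem_filter] at hx
  refine ⟨x, hx.1, fun a ha => ?_⟩
  rcases (hmax a ha).lt_or_eq with h | h
  · exact Or.inl (h.trans_eq hx.2.symm)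
  · exact Or.inr ⟨h.trans hx.2.symm, hmin a (mem_filter.2 ⟨ha, h⟩)⟩

/-- The reverse reading word of the filling `T` of the boxes in `S` is a lattice word, for entries
starting at `0`. -/
def IsRowLattice (S : Finset (ℕ × ℕ)) (T : ℕ × ℕ → ℕ) : Prop :=
  ∀ b ∈ S, ∀ k, #{a ∈ S | ReadBefore a b ∧ T a = k + 1} ≤ #{a ∈ S | ReadBefore a b ∧ T a = k}

theorem IsRowLattice.isColumnLattice (hS : (S : Set (ℕ × ℕ)).OrdConnected) (hT : IsTableau S T)
    (h : IsRowLattice S T) : IsColumnLattice S T := by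
  intro j k
  rcases {x ∈ S | j ≤ x.2 ∧ T x = k + 1}.eq_empty_or_nonempty with he | hne
  · rw [countGE, he]
    exact Nat.zero_le _
  -- `i` is the lowest row with an entry `k + 1` in the columns from `j` on; the initial segment
  -- to use ends with the leftmost `k + 1` of that row, in whatever column it lies.
  obtain ⟨⟨i, c⟩, hx, hlast⟩ := exists_last_readBefore hne
  simp only [mem_filter] at hx
  obtain ⟨hxS, hjc, hxk⟩ := hx
  obtain ⟨⟨i', c₀⟩, hy, hleft⟩ := exists_last_readBefore (A := {x ∈ S | x.1 = i ∧ T x = k + 1})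
    ⟨(i, c), mem_filter.2 ⟨hxS, rfl, hxk⟩⟩
  simp only [mem_filter] at hy
  obtain ⟨hyS, rfl, hyk⟩ := hy
  have hleft' : ∀ d, (i', d) ∈ S → T (i', d) = k + 1 → c₀ ≤ d := by
    intro d hd hdk
    have := hleft (i', d) (mem_filter.2 ⟨hd, rfl, hdk⟩)
    simp only [ReadBefore] at this
    omega
  have hlat := h (i', c₀) hyS k
  rw [← card_filter_add_card_filter_not (s := {a ∈ S | ReadBefore a (i', c₀) ∧ T a = k + 1})
      (fun a => j ≤ a.2),
    ← card_filter_add_card_filter_not (s := {a ∈ S | ReadBefore a (i', c₀) ∧ T a = k})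
      (fun a => j ≤ a.2)] at hlat
  simp only [filter_filter] at hlat
  have h1 : countGE S T j (k + 1) ≤
      #{a ∈ S | (ReadBefore a (i', c₀) ∧ T a = k + 1) ∧ j ≤ a.2} := by
    refine card_le_card ?_
    rintro ⟨r, d⟩ ha
    have ha' := hlast _ ha
    simp only [mem_filter] at ha ⊢
    refine ⟨ha.1, ⟨?_, ha.2.2⟩, ha.2.1⟩
    rcases ha' with hlt | ⟨he, -⟩
    · exact Or.inl hlt
    · simp only at he
      subst he
      exact Or.inr ⟨rfl, hleft' d ha.1 ha.2.2⟩
  have h2 : #{a ∈ S | (ReadBefore a (i', c₀) ∧ T a = k) ∧ j ≤ a.2} ≤ countGE S T j k := by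
    refine card_le_card fun a ha => ?_
    simp only [mem_filter] at ha ⊢
    exact ⟨ha.1, ha.2.2, ha.2.1.2⟩
  -- In the columns before `j`, every `k` of the segment lies above a `k + 1` of row `i'`.
  have h3 : #{a ∈ S | (ReadBefore a (i', c₀) ∧ T a = k) ∧ ¬ j ≤ a.2} ≤
      #{a ∈ S | (ReadBefore a (i', c₀) ∧ T a = k + 1) ∧ ¬ j ≤ a.2} := by
    refine card_le_card_of_injOn (fun a => (i', a.2)) ?_ ?_
    · rintro ⟨r, d⟩ ha
      replace ha := mem_filter.1 (mem_coe.1 ha)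
      refine mem_coe.2 (mem_filter.2 ?_)
      simp only [ReadBefore] at ha
      obtain ⟨haS, ⟨hr, hak⟩, hd⟩ := ha
      have hri : r < i' := by
        rcases hr with hr | ⟨rfl, hcd⟩
        · exact hr
        · have := hT.row hyS haS hcd
          omega
      have hm := mem_of_corners hS haS hxS hri.le le_rfl le_rfl (by omega : d ≤ c)
      have h4 := hT.col haS hm hri
      have h5 := hT.row hm hxS (by omega : d ≤ c)
      have h6 : T (i', d) = k + 1 := by omega
      exact ⟨hm, ⟨Or.inr ⟨rfl, hleft' d hm h6⟩, h6⟩, hd⟩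
    · rintro ⟨r, d⟩ ha ⟨r', d'⟩ hb hab
      replace ha := mem_filter.1 (mem_coe.1 ha)
      replace hb := mem_filter.1 (mem_coe.1 hb)
      obtain rfl : d = d' := (Prod.ext_iff.1 hab).2
      rw [hT.row_eq ha.1 hb.1 (ha.2.1.2.trans hb.2.1.2.symm)]
  omega

theorem IsColumnLattice.isRowLattice (hS : (S : Set (ℕ × ℕ)).OrdConnected) (hT : IsTableau S T)
    (h : IsColumnLattice S T) : IsRowLattice S T := by
  intro b _ k
  rcases {a ∈ S | ReadBefore a b ∧ T a = k + 1}.eq_empty_or_nonempty with he | hne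
  · rw [he]
    exact Nat.zero_le _
  -- Compare the segment with the columns from that of its last entry `k + 1` on.
  obtain ⟨⟨i, c⟩, hx, hlast⟩ := exists_last_readBefore hne
  simp only [mem_filter] at hx
  obtain ⟨hxS, hxb, hxk⟩ := hx
  refine le_trans (card_le_card ?_) ((h c k).trans (card_le_card ?_))
  · rintro ⟨r, d⟩ ha
    have ha' := hlast _ ha
    simp only [mem_filter] at ha ⊢
    refine ⟨ha.1, ?_, ha.2.2⟩
    rcases ha' with hlt | ⟨-, hle⟩
    · by_contra hdc
      simp only at hlt hdc
      have hm := mem_of_corners hS ha.1 hxS hlt.le le_rfl le_rfl (not_le.1 hdc).le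
      have h1 := hT.col ha.1 hm hlt
      have h2 := hT.row hm hxS (not_le.1 hdc).le
      omega
    · exact hle
  · rintro ⟨r, d⟩ ha
    simp only [mem_filter] at ha ⊢
    refine ⟨ha.1, ReadBefore.trans ?_ hxb, ha.2.2⟩
    rcases lt_trichotomy r i with hr | rfl | hr
    · exact Or.inl hr
    · exact Or.inr ⟨rfl, ha.2.1⟩
    · have hm := mem_of_corners hS hxS ha.1 le_rfl hr.le ha.2.1 le_rfl
      have h1 := hT.row hxS hm ha.2.1
      have h2 := hT.col hm ha.1 hr
      omega

/-- For a tableau, reading by rows or by columns gives the same lattice condition. -/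
theorem isRowLattice_iff (hS : (S : Set (ℕ × ℕ)).OrdConnected) (hT : IsTableau S T) :
    IsRowLattice S T ↔ IsColumnLattice S T :=
  ⟨fun h => h.isColumnLattice hS hT, fun h => h.isRowLattice hS hT⟩

/-! ### Straight shapes -/

theorem IsColumnLattice.weight_antitone (h : IsColumnLattice S T) : Antitone (weight S T) := by
  refine antitone_nat_of_succ_le fun k => ?_
  simpa [countGE, weight] using h 0 k

theorem sum_weight (S : Finset (ℕ × ℕ)) {N : ℕ} (hT : ∀ x ∈ S, T x < N) :
    ∑ i ∈ range N, weight S T i = #S :=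
  (card_eq_sum_card_fiberwise fun x hx => mem_coe.2 (mem_range.2 (hT x hx))).symm

/-- The superstandard filling, whose row `i` is constant `i`. -/
def rowFilling (S : Finset (ℕ × ℕ)) (x : ℕ × ℕ) : ℕ := if x ∈ S then x.1 else 0

theorem isTableau_rowFilling (S : Finset (ℕ × ℕ)) : IsTableau S (rowFilling S) where
  row h h' _ := by simp [rowFilling, h, h']
  col h h' hr := by simpa [rowFilling, h, h'] using hr
  off h := by simp [rowFilling, h]

variable (nu : YoungDiagram)

theorem weight_rowFilling (i : ℕ) : weight nu.cells (rowFilling nu.cells) i = nu.rowLen i := by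
  rw [weight, YoungDiagram.rowLen_eq_card, YoungDiagram.row]
  congr 1
  exact filter_congr fun x hx => by simp [rowFilling, hx]

theorem isColumnLattice_rowFilling : IsColumnLattice nu.cells (rowFilling nu.cells) := by
  intro j k
  refine card_le_card_of_injOn (fun x => (k, x.2)) ?_ ?_
  · rintro ⟨r, c⟩ hx
    replace hx := mem_filter.1 (mem_coe.1 hx)
    refine mem_coe.2 (mem_filter.2 ?_)
    simp only [YoungDiagram.mem_cells, rowFilling] at hx ⊢
    obtain ⟨hx, hc, hr⟩ := hx
    rw [if_pos hx] at hr
    have hm : (k, c) ∈ nu := nu.up_left_mem (by omega) le_rfl hx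
    exact ⟨hm, hc, by rw [if_pos hm]⟩
  · rintro ⟨r, c⟩ hx ⟨r', c'⟩ hy hxy
    replace hx := mem_filter.1 (mem_coe.1 hx)
    replace hy := mem_filter.1 (mem_coe.1 hy)
    simp only [YoungDiagram.mem_cells, rowFilling] at hx hy
    rw [if_pos hx.1] at hx
    rw [if_pos hy.1] at hy
    obtain rfl : c = c' := (Prod.ext_iff.1 hxy).2
    obtain ⟨-, -, hx⟩ := hx
    obtain ⟨-, -, hy⟩ := hy
    rw [hx, hy]

theorem ordConnected_skewCells (lam mu : YoungDiagram) :
    (skewCells lam mu : Set (ℕ × ℕ)).OrdConnected := by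
  refine ⟨fun a ha b hb x hx => ?_⟩
  simp only [skewCells, coe_sdiff, Set.mem_sdiff, mem_coe] at ha hb ⊢
  exact ⟨lam.isLowerSet hx.2 hb.1, fun h => ha.2 (mu.isLowerSet hx.1 h)⟩

theorem skewCells_bot : skewCells nu ⊥ = nu.cells := by
  simp [skewCells]

theorem ordConnected_cells : (nu.cells : Set (ℕ × ℕ)).OrdConnected :=
  skewCells_bot nu ▸ ordConnected_skewCells nu ⊥

/-- A straight shape has only one lattice tableau. -/
theorem IsColumnLattice.eq_rowFilling {nu : YoungDiagram} (hT : IsTableau nu.cells T)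
    (h : IsColumnLattice nu.cells T) : T = rowFilling nu.cells := by
  have hlow : ∀ r c, (r, c) ∈ nu → r ≤ T (r, c) := by
    intro r
    induction r with
    | zero => exact fun _ _ => Nat.zero_le _
    | succ r ih =>
      intro c hc
      have hm : (r, c) ∈ nu := nu.up_left_mem (Nat.le_succ r) le_rfl hc
      have h1 := ih c hm
      have h2 := hT.col ((YoungDiagram.mem_cells _).2 hm) ((YoungDiagram.mem_cells _).2 hc)
        (Nat.lt_succ_self r)
      omega
  have hup : ∀ r c, (r, c) ∈ nu → T (r, c) ≤ r := by
    intro r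
    induction r using Nat.strong_induction_on with
    | _ r ih =>
    intro c hc
    -- The rightmost entry `v` of the row comes first; if `v > r`, no `v - 1` has been read yet.
    obtain ⟨⟨r', d⟩, hd, hmax⟩ := exists_max_image {x ∈ nu.cells | x.1 = r} Prod.snd
      ⟨(r, c), by simpa using hc⟩
    simp only [mem_filter] at hd
    obtain ⟨hd, rfl⟩ := hd
    refine (hT.row ((YoungDiagram.mem_cells _).2 hc) hd
      (hmax (r', c) (by simpa using hc))).trans ?_
    by_contra hlt
    obtain ⟨v, hv⟩ : ∃ v, T (r', d) = v + 1 := Nat.exists_eq_succ_of_ne_zero (by omega)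
    have hlat := h.isRowLattice (ordConnected_cells nu) hT (r', d) hd v
    have hpos : 0 < #{a ∈ nu.cells | ReadBefore a (r', d) ∧ T a = v + 1} :=
      card_pos.2 ⟨(r', d), mem_filter.2 ⟨hd, Or.inr ⟨rfl, le_rfl⟩, hv⟩⟩
    obtain ⟨⟨a, b⟩, hab⟩ := card_pos.1 (hpos.trans_le hlat)
    rw [mem_filter] at hab
    obtain ⟨hab, hread, hval⟩ := hab
    rcases hread with hlt' | ⟨rfl, hdb⟩
    · have := ih a hlt' b ((YoungDiagram.mem_cells _).1 hab)
      simp only at hlt'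
      omega
    · have := hT.row hd hab hdb
      simp only at *
      omega
  funext ⟨r, c⟩
  by_cases hx : (r, c) ∈ nu.cells
  · rw [rowFilling, if_pos hx]
    exact le_antisymm (hup r c hx) (hlow r c hx)
  · rw [hT.off hx, rowFilling, if_neg hx]

theorem fst_lt_card {x : ℕ × ℕ} (hx : x ∈ nu.cells) : x.1 < nu.card := by
  have h1 : nu.colLen x.2 ≤ nu.card := by
    rw [YoungDiagram.colLen_eq_card]
    exact card_le_card (filter_subset _ _)
  exact (YoungDiagram.mem_iff_lt_colLen.1 ((YoungDiagram.mem_cells _).1 hx)).trans_le h1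

open Classical in
theorem alternant_staircase_mul_schurPoly_cells {N : ℕ} (hN : nu.card ≤ N) :
    alternant (staircase N) * schurPoly nu.cells N =
      alternant (fun i => nu.rowLen i + staircase N i) := by
  rw [alternant_staircase_mul_schurPoly (ordConnected_cells nu)]
  have : {T ∈ tableaux nu.cells N | IsColumnLattice nu.cells T} = {rowFilling nu.cells} := by
    ext T
    rw [mem_filter, mem_tableaux, mem_singleton]
    constructor
    · rintro ⟨⟨hT, -⟩, h⟩
      exact h.eq_rowFilling hT
    · rintro rfl
      refine ⟨⟨isTableau_rowFilling _, fun x hx => ?_⟩, isColumnLattice_rowFilling nu⟩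
      rw [rowFilling, if_pos hx]
      exact (fst_lt_card nu hx).trans_le hN
  rw [this, sum_singleton]
  simp only [weight_rowFilling]

theorem sum_rowLen {N : ℕ} (hN : nu.card ≤ N) : ∑ i ∈ range N, nu.rowLen i = nu.card := by
  have h := sum_weight nu.cells (T := rowFilling nu.cells) (N := N) fun x hx => by
    rw [rowFilling, if_pos hx]
    exact (fst_lt_card nu hx).trans_le hN
  simpa only [weight_rowFilling] using h

variable {nu} in
theorem eq_of_rowLen_eq {nu' : YoungDiagram} (h : ∀ i, nu.rowLen i = nu'.rowLen i) :
    nu = nu' := by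
  ext ⟨i, j⟩
  simp only [YoungDiagram.mem_cells, YoungDiagram.mem_iff_lt_rowLen, h]

/-! ### The Littlewood-Richardson rule for Schur polynomials -/

/-- The weight of a lattice tableau is a partition. -/
theorem exists_rowLen_eq_weight {N : ℕ} (hT : T ∈ tableaux S N) (h : IsColumnLattice S T) :
    ∃ nu : YoungDiagram, nu.card = #S ∧ ∀ i, weight S T i = nu.rowLen i := by
  have hw : ∀ i, weight S T i ≤ #S := fun i => card_filter_le _ _
  have h0 : ∀ i, 0 < weight S T i → i < N := by
    intro i hi
    obtain ⟨x, hx⟩ := card_pos.1 hi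
    rw [mem_filter] at hx
    exact hx.2 ▸ (mem_tableaux.1 hT).2 x hx.1
  let nu : YoungDiagram :=
    ⟨{x ∈ range N ×ˢ range #S | x.2 < weight S T x.1}, by
      rintro ⟨a, b⟩ ⟨a', b'⟩ ⟨ha, hb⟩ hab
      simp only [coe_filter, mem_product, mem_range, Set.mem_ofPred_eq] at hab ⊢
      simp only at ha hb
      have := h.weight_antitone ha
      omega⟩
  have hmem : ∀ i j, (i, j) ∈ nu ↔ j < weight S T i := by
    intro i j
    rw [← YoungDiagram.mem_cells]
    simp only [nu, mem_filter, mem_product, mem_range]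
    refine ⟨fun h => h.2, fun h => ⟨⟨h0 i (by omega), h.trans_le (hw i)⟩, h⟩⟩
  have hrow : ∀ i, weight S T i = nu.rowLen i := by
    intro i
    refine eq_of_forall_lt_iff fun j => ?_
    rw [← hmem, YoungDiagram.mem_iff_lt_rowLen]
  refine ⟨nu, ?_, hrow⟩
  have h1 := sum_weight S (N := N + nu.card) fun x hx => ((mem_tableaux.1 hT).2 x hx).trans_le
    (Nat.le_add_right _ _)
  have h2 := sum_rowLen nu (Nat.le_add_left nu.card N)
  exact h2.symm.trans ((sum_congr rfl fun i _ => (hrow i).symm).trans h1)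

open Classical in
/-- The number of lattice tableaux on `S` with entries below `N` and weight `nu`. -/
noncomputable def latticeCount (S : Finset (ℕ × ℕ)) (N : ℕ) (nu : YoungDiagram) : ℕ :=
  #{T ∈ tableaux S N | IsColumnLattice S T ∧ ∀ i, weight S T i = nu.rowLen i}

open Classical in
/-- The Littlewood-Richardson rule for Schur polynomials. -/
theorem schurPoly_eq_sum (hS : (S : Set (ℕ × ℕ)).OrdConnected) {N : ℕ} (hN : #S ≤ N) :
    schurPoly S N = ∑ nu ∈ partitionsOf #S, latticeCount S N nu • schurPoly nu.cells N := by
  refine mul_left_cancel₀ (alternant_staircase_ne_zero N) ?_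
  rw [alternant_staircase_mul_schurPoly hS, mul_sum]
  have hex : ∀ T ∈ {T ∈ tableaux S N | IsColumnLattice S T},
      ∃ nu : YoungDiagram, nu.card = #S ∧ ∀ i, weight S T i = nu.rowLen i := fun T hT =>
    exists_rowLen_eq_weight (mem_filter.1 hT).1 (mem_filter.1 hT).2
  choose! f hf using hex
  rw [← sum_fiberwise_of_maps_to (g := f) fun T hT => mem_partitionsOf.2 (hf T hT).1]
  refine sum_congr rfl fun nu hnu => ?_
  rw [mul_smul_comm, alternant_staircase_mul_schurPoly_cells nu
    ((mem_partitionsOf.1 hnu).le.trans hN), latticeCount, ← sum_const, filter_filter]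
  refine sum_congr ?_ fun T hT => ?_
  · ext T
    simp only [mem_filter]
    constructor
    · rintro ⟨hT, h, rfl⟩
      exact ⟨hT, h, (hf T (mem_filter.2 ⟨hT, h⟩)).2⟩
    · rintro ⟨hT, h, hw⟩
      refine ⟨hT, h, eq_of_rowLen_eq fun i => ?_⟩
      rw [← hw, (hf T (mem_filter.2 ⟨hT, h⟩)).2]
  · simp only [(mem_filter.1 hT).2.2]

variable {lam mu : YoungDiagram}

/-! ### Semistandard tableaux as fillings -/

theorem card_filter_subtype (S : Finset (ℕ × ℕ)) (p : ℕ × ℕ → Prop) [DecidablePred p] :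
    #{b : {b : ℕ × ℕ // b ∈ S} | p b.1} = #{x ∈ S | p x} := by
  refine card_bij (fun b _ => b.1) (fun b hb => ?_) (fun a _ b _ h => Subtype.ext h) fun b hb => ?_
  · exact mem_filter.2 ⟨b.2, (mem_filter.1 hb).2⟩
  · exact ⟨⟨b, (mem_filter.1 hb).1⟩, mem_filter.2 ⟨mem_univ _, (mem_filter.1 hb).2⟩, rfl⟩

/-- The filling of a semistandard tableau with its entries lowered by one, and `0` off the
shape. -/
def toFilling (T : SkewSSYT lam mu) (x : ℕ × ℕ) : ℕ :=
  if h : x ∈ skewCells lam mu then (T.entry ⟨x, h⟩).natPred else 0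

theorem toFilling_coe (T : SkewSSYT lam mu) (b : {b : ℕ × ℕ // b ∈ skewCells lam mu}) :
    toFilling T b.1 = (T.entry b).natPred := dif_pos b.2

theorem isTableau_toFilling (T : SkewSSYT lam mu) :
    IsTableau (skewCells lam mu) (toFilling T) where
  row {r c c'} h h' hc := by
    rcases hc.eq_or_lt with rfl | hlt
    · exact le_rfl
    · rw [toFilling, toFilling, dif_pos h, dif_pos h']
      exact PNat.natPred_le_natPred.2 (T.row_weak ⟨_, h⟩ ⟨_, h'⟩ rfl hlt)
  col h h' hr := by
    rw [toFilling, toFilling, dif_pos h, dif_pos h']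
    exact PNat.natPred_lt_natPred.2 (T.col_strict ⟨_, h⟩ ⟨_, h'⟩ rfl hr)
  off h := dif_neg h

/-- Semistandard tableaux as tableaux with entries starting at `0`. -/
def skewSSYTEquiv (lam mu : YoungDiagram) :
    SkewSSYT lam mu ≃ {T : ℕ × ℕ → ℕ // IsTableau (skewCells lam mu) T} where
  toFun T := ⟨toFilling T, isTableau_toFilling T⟩
  invFun T :=
    { entry := fun b => (T.1 b.1).succPNat
      row_weak := by
        rintro ⟨⟨r, c⟩, ha⟩ ⟨⟨r', c'⟩, hb⟩ (rfl : r = r') hc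
        exact Nat.succPNat_le_succPNat.2 (T.2.row ha hb (le_of_lt hc))
      col_strict := by
        rintro ⟨⟨r, c⟩, ha⟩ ⟨⟨r', c'⟩, hb⟩ (rfl : c = c') hr
        exact Nat.succPNat_lt_succPNat.2 (T.2.col ha hb hr) }
  left_inv T := by
    ext b
    simp [toFilling_coe]
  right_inv T := by
    refine Subtype.ext (funext fun x => ?_)
    by_cases hx : x ∈ skewCells lam mu
    · simp [toFilling, hx]
    · simp [toFilling, hx, T.2.off hx]

theorem card_entry_eq (T : SkewSSYT lam mu) (k : ℕ+) :
    #{b | T.entry b = k} = weight (skewCells lam mu) (toFilling T) k.natPred := by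
  rw [weight, ← card_filter_subtype]
  simp only [toFilling_coe, PNat.natPred_inj]

theorem hasContent_iff (T : SkewSSYT lam mu) (nu : YoungDiagram) :
    HasContent T nu ↔ ∀ i, weight (skewCells lam mu) (toFilling T) i = nu.rowLen i := by
  unfold HasContent
  simp only [card_entry_eq]
  constructor
  · intro h i
    simpa using h i.succPNat
  · intro h k
    exact h _

theorem isLattice_iff (T : SkewSSYT lam mu) :
    IsLattice T ↔ IsColumnLattice (skewCells lam mu) (toFilling T) := by
  rw [← isRowLattice_iff (ordConnected_skewCells lam mu) (isTableau_toFilling T)]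
  have key : ∀ (b : ℕ × ℕ) (k : ℕ+),
      #{a : {b : ℕ × ℕ // b ∈ skewCells lam mu} | ReadBefore a.1 b ∧ T.entry a = k} =
      #{a ∈ skewCells lam mu | ReadBefore a b ∧ toFilling T a = k.natPred} := by
    intro b k
    rw [← card_filter_subtype]
    simp only [toFilling_coe, PNat.natPred_inj]
  unfold IsLattice
  simp only [key]
  constructor
  · intro h b hb k
    exact h ⟨b, hb⟩ k.succPNat
  · intro h b k
    obtain ⟨k, rfl⟩ : ∃ i : ℕ, k = i.succPNat := ⟨k.natPred, by simp⟩
    exact h b.1 b.2 k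

open Classical in
theorem natCard_skewSSYT (N : ℕ) (p : (ℕ × ℕ → ℕ) → Prop)
    (hp : ∀ T, IsTableau (skewCells lam mu) T → p T → ∀ x ∈ skewCells lam mu, T x < N) :
    Nat.card {T : SkewSSYT lam mu // p (toFilling T)} =
      #{T ∈ tableaux (skewCells lam mu) N | p T} := by
  rw [← Nat.card_eq_finsetCard]
  refine Nat.card_congr (((skewSSYTEquiv lam mu).subtypeEquiv (q := fun T => p T.1)
    fun T => Iff.rfl).trans ((Equiv.subtypeSubtypeEquivSubtypeInter _ _).trans
      (Equiv.subtypeEquivRight fun T => ?_)))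
  rw [mem_filter, mem_tableaux]
  exact ⟨fun h => ⟨⟨h.1, hp T h.1 h.2⟩, h.2⟩, fun h => ⟨h.1.1, h.2⟩⟩

theorem lt_of_weight_pos {S : Finset (ℕ × ℕ)} {T : ℕ × ℕ → ℕ} {N : ℕ}
    (h : ∀ i, 0 < weight S T i → i < N) : ∀ x ∈ S, T x < N :=
  fun x hx => h _ (card_pos.2 ⟨x, mem_filter.2 ⟨hx, rfl⟩⟩)

theorem lrCoeff_eq_latticeCount (nu : YoungDiagram) {N : ℕ} (hN : nu.card ≤ N) :
    lrCoeff lam mu nu = latticeCount (skewCells lam mu) N nu := by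
  classical
  have h := natCard_skewSSYT (lam := lam) (mu := mu) N
    (fun T => IsColumnLattice (skewCells lam mu) T ∧
      ∀ i, weight (skewCells lam mu) T i = nu.rowLen i) fun T _ hT =>
    lt_of_weight_pos fun i hi => by
      rw [hT.2] at hi
      exact (fst_lt_card nu (x := (i, 0))
        ((YoungDiagram.mem_cells _).2 (YoungDiagram.mem_iff_lt_rowLen.2 hi))).trans_le hN
  refine (Nat.card_congr (Equiv.subtypeEquivRight fun T => ?_)).trans (h.trans ?_)
  · rw [hasContent_iff, isLattice_iff, and_comm]
  · rw [latticeCount]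
    congr

/-! ### Kostka numbers as coefficients -/

open Classical in
theorem coeff_schurPoly (S : Finset (ℕ × ℕ)) {N : ℕ} (d : Fin N →₀ ℕ) :
    coeff d (schurPoly S N) = #{T ∈ tableaux S N | ∀ i : Fin N, weight S T i = d i} := by
  rw [schurPoly, coeff_sum, card_filter, Nat.cast_sum]
  refine sum_congr rfl fun T _ => ?_
  have : ∏ i : Fin N, (X i : MvPolynomial (Fin N) ℤ) ^ weight S T i =
      monomial (Finsupp.equivFunOnFinite.symm fun i : Fin N => weight S T i) 1 := by
    rw [monomial_eq, C_1, one_mul, Finsupp.prod_fintype _ _ (by simp)]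
    rfl
  rw [this, coeff_monomial, Nat.cast_ite]
  simp only [Finsupp.ext_iff, Finsupp.equivFunOnFinite_symm_apply_apply, Nat.cast_one,
    Nat.cast_zero]

/-- The Kostka number of the shape `lam / mu` and the content of the word `w`. -/
noncomputable def kostka (lam mu : YoungDiagram) (w : FreeMonoid ℕ+) : ℕ :=
  Nat.card {T : SkewSSYT lam mu // ∀ k : ℕ+, #{b | T.entry b = k} = w.toList.count k}

theorem kostka_eq_coeff {N : ℕ} (w : FreeMonoid ℕ+) (hN : ∀ k ∈ w.toList, k.natPred < N) :
    (kostka lam mu w : ℤ) = coeff (Finsupp.equivFunOnFinite.symm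
      fun i : Fin N => w.toList.count (i : ℕ).succPNat) (schurPoly (skewCells lam mu) N) := by
  classical
  have hN' : ∀ i : ℕ, 0 < w.toList.count i.succPNat → i < N := by
    intro i hi
    simpa using hN _ (List.count_pos_iff.1 hi)
  have h : kostka lam mu w = Nat.card {T : SkewSSYT lam mu //
      ∀ i, weight (skewCells lam mu) (toFilling T) i = w.toList.count i.succPNat} := by
    refine Nat.card_congr (Equiv.subtypeEquivRight fun T => ?_)
    simp only [card_entry_eq]
    constructor
    · intro h i
      simpa using h i.succPNat
    · intro h k
      simpa using h k.natPred
  rw [h, natCard_skewSSYT N (fun T => ∀ i, weight (skewCells lam mu) T i =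
    w.toList.count i.succPNat), coeff_schurPoly]
  · congr 2
    refine filter_congr fun T hT => ⟨fun h i => by simp [h], fun h i => ?_⟩
    by_cases hi : i < N
    · simpa using h ⟨i, hi⟩
    · have h1 : w.toList.count i.succPNat = 0 := by
        by_contra hne
        exact hi (hN' i (Nat.pos_of_ne_zero hne))
      rw [h1]
      refine card_eq_zero.2 (filter_eq_empty_iff.2 fun x hx hxi => hi ?_)
      exact hxi ▸ (mem_tableaux.1 hT).2 x hx
  · intro T _ hw
    refine lt_of_weight_pos fun i hi => hN' i ?_
    rwa [← hw]

/-! ### Coefficients of Rosas-Sagan functions -/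

/-- The number of rearrangements of the positions of `w` that leave `w` unchanged. -/
noncomputable def stabilizerCard (w : List ℕ+) : ℕ :=
  Nat.card {σ : Equiv.Perm (Fin w.length) // w.get ∘ σ = w.get}

theorem nonempty_perm_comp_eq_equiv {α β : Type*} {f g : α → β}
    (h : ∃ σ : Equiv.Perm α, g ∘ σ = f) :
    Nonempty ({σ : Equiv.Perm α // g ∘ σ = f} ≃ {σ : Equiv.Perm α // f ∘ σ = f}) := by
  obtain ⟨τ, rfl⟩ := h
  refine ⟨(Equiv.mulLeft τ⁻¹).subtypeEquiv fun σ => ?_⟩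
  simp [Function.comp_def]

theorem exists_perm_comp_eq_iff {α β : Type*} [Fintype α] [DecidableEq β] (f g : α → β) :
    (∃ σ : Equiv.Perm α, g ∘ σ = f) ↔ ∀ k, #{i | g i = k} = #{i | f i = k} := by
  constructor
  · rintro ⟨σ, rfl⟩ k
    exact (card_bij (fun i _ => σ i) (by simp) (by simp) fun i hi =>
      ⟨σ.symm i, by simpa using hi, by simp⟩).symm
  · intro h
    have e : ∀ k, Nonempty ({i // f i = k} ≃ {i // g i = k}) := fun k =>
      Fintype.card_eq.1 (by rw [Fintype.card_subtype, Fintype.card_subtype, h])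
    refine ⟨(Equiv.sigmaFiberEquiv f).symm.trans ((Equiv.sigmaCongrRight fun k => (e k).some).trans
      (Equiv.sigmaFiberEquiv g)), ?_⟩
    funext i
    exact ((e (f i)).some ⟨i, rfl⟩).2

theorem card_get_eq_count (w : List ℕ+) (k : ℕ+) : #{i | w.get i = k} = w.count k := by
  have := Fin.card_filter_univ_eq_vector_get_eq_count k (⟨w, rfl⟩ : List.Vector ℕ+ w.length)
  simpa [List.Vector.get, eq_comm] using this

/-- The labelling `e` has a free length `m`, so that `m` can be replaced by the length of `w`. -/
theorem natCard_ofFn_eq {m : ℕ} (e : Fin m ≃ {b : ℕ × ℕ // b ∈ skewCells lam mu})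
    (w : FreeMonoid ℕ+) :
    Nat.card {p : Equiv.Perm (Fin m) × SkewSSYT lam mu //
      List.ofFn (fun k => p.2.entry (e (p.1 k))) = w.toList} =
      stabilizerCard w.toList * kostka lam mu w := by
  by_cases hm : w.toList.length = m
  · subst hm
    have hC : ∀ T : SkewSSYT lam mu, (∀ k : ℕ+, #{b | T.entry b = k} = w.toList.count k) ↔
        ∃ σ : Equiv.Perm (Fin w.toList.length), (T.entry ∘ e) ∘ σ = w.toList.get := by
      intro T
      rw [exists_perm_comp_eq_iff]
      refine forall_congr' fun k => ?_
      have he : #{i | (T.entry ∘ e) i = k} = #{b | T.entry b = k} :=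
        card_bij (fun i _ => e i) (by simp) (by simp) fun i hi =>
          ⟨e.symm i, by simpa using hi, by simp⟩
      rw [card_get_eq_count, he]
    have hQ : ∀ (T : SkewSSYT lam mu) (σ : Equiv.Perm (Fin w.toList.length)),
        List.ofFn (fun k => T.entry (e (σ k))) = w.toList ↔
          (T.entry ∘ e) ∘ σ = w.toList.get := by
      intro T σ
      refine Iff.trans ?_ (List.ofFn_injective (n := w.toList.length)).eq_iff
      rw [List.ofFn_get]
      rfl
    let E1 : {p : Equiv.Perm (Fin w.toList.length) × SkewSSYT lam mu //
        List.ofFn (fun k => p.2.entry (e (p.1 k))) = w.toList} ≃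
        Σ T : SkewSSYT lam mu,
          {σ : Equiv.Perm (Fin w.toList.length) // (T.entry ∘ e) ∘ σ = w.toList.get} :=
      ((Equiv.prodComm _ _).subtypeEquiv fun p => hQ p.2 p.1).trans
        (Equiv.subtypeProdEquivSigmaSubtype
          fun (T : SkewSSYT lam mu) (σ : Equiv.Perm (Fin w.toList.length)) =>
            (T.entry ∘ e) ∘ σ = w.toList.get)
    let E2 := (Equiv.sigmaSubtypeEquivOfSubset
      (fun T : SkewSSYT lam mu =>
        {σ : Equiv.Perm (Fin w.toList.length) // (T.entry ∘ e) ∘ σ = w.toList.get})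
      (fun T : SkewSSYT lam mu => ∀ k : ℕ+, #{b | T.entry b = k} = w.toList.count k)
      fun T σ => (hC T).2 ⟨σ.1, σ.2⟩).symm
    let E3 := (Equiv.sigmaCongrRight
      fun T : {T : SkewSSYT lam mu // ∀ k : ℕ+, #{b | T.entry b = k} = w.toList.count k} =>
        (nonempty_perm_comp_eq_equiv ((hC T.1).1 T.2)).some).trans (Equiv.sigmaEquivProd _ _)
    rw [Nat.card_congr (E1.trans (E2.trans E3)), Nat.card_prod, mul_comm]
    rfl
  · -- A word of the wrong length is not the content of any tableau.
    have h1 : IsEmpty {p : Equiv.Perm (Fin m) × SkewSSYT lam mu //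
        List.ofFn (fun k => p.2.entry (e (p.1 k))) = w.toList} :=
      ⟨fun p => hm (by rw [← p.2, List.length_ofFn])⟩
    have h2 : IsEmpty {T : SkewSSYT lam mu //
        ∀ k : ℕ+, #{b | T.entry b = k} = w.toList.count k} := by
      refine ⟨fun T => hm ?_⟩
      have h : Multiset.map T.1.entry univ.val = (w.toList : Multiset ℕ+) := by
        ext k
        rw [Multiset.count_map, Multiset.coe_count, ← T.2 k]
        simp only [eq_comm (a := k)]
        rfl
      have h' := congrArg Multiset.card h
      rw [Multiset.card_map, Multiset.coe_card] at h'
      rw [← h', ← Fintype.card_fin m, Fintype.card_congr e]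
      rfl
    rw [Nat.card_of_isEmpty, kostka, Nat.card_of_isEmpty, mul_zero]

/-- Every tableau with the content of `w` gives `w` equally often, so that a coefficient of a
Rosas-Sagan function is a Kostka number times a factor that depends on the word only. -/
theorem rosasSaganSkew_apply (lam mu : YoungDiagram) (w : FreeMonoid ℕ+) :
    rosasSaganSkew lam mu w = stabilizerCard w.toList * kostka lam mu w := by
  rw [← Nat.cast_mul, ← natCard_ofFn_eq (boxLabel lam mu)]
  rfl

end NCSchur

open NCSchur

theorem proposition5p10 (lam mu : YoungDiagram) (n : ℕ) (hmu : mu ≤ lam)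
    (hn : lam.card = mu.card + n) :
    NCSchur.rosasSaganSkew lam mu =
      ∑ nu ∈ NCSchur.partitionsOf n,
        (NCSchur.lrCoeff lam mu nu : ℚ) • NCSchur.rosasSagan nu := by
  have hS : (skewCells lam mu).card = n := by
    rw [skewCells, Finset.card_sdiff_of_subset hmu]
    exact (Nat.sub_eq_iff_eq_add (Finset.card_le_card hmu)).2 (by rw [add_comm]; exact hn)
  funext w
  -- Enough variables for all letters of `w` and for the rows of all partitions of `n`.
  obtain ⟨N, hnN, hN⟩ : ∃ N, n ≤ N ∧ ∀ k ∈ w.toList, k.natPred < N := by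
    refine ⟨n + (w.toList.toFinset.sup PNat.natPred + 1), by omega, fun k hk => ?_⟩
    have := Finset.le_sup (f := PNat.natPred) (List.mem_toFinset.2 hk)
    omega
  have key : (kostka lam mu w : ℤ) =
      ∑ nu ∈ partitionsOf n, (lrCoeff lam mu nu : ℤ) * kostka nu ⊥ w := by
    rw [kostka_eq_coeff w hN, schurPoly_eq_sum (ordConnected_skewCells lam mu) (hS.le.trans hnN),
      hS, MvPolynomial.coeff_sum]
    refine Finset.sum_congr rfl fun nu hnu => ?_
    rw [kostka_eq_coeff w hN, skewCells_bot,
      lrCoeff_eq_latticeCount nu ((mem_partitionsOf.1 hnu).le.trans hnN), nsmul_eq_mul,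
      ← map_natCast (MvPolynomial.C (R := ℤ)), MvPolynomial.coeff_C_mul]
  have key' : (kostka lam mu w : ℚ) =
      ∑ nu ∈ partitionsOf n, (lrCoeff lam mu nu : ℚ) * kostka nu ⊥ w := by
    exact_mod_cast key
  rw [rosasSaganSkew_apply, key', Finset.sum_apply, Finset.mul_sum]
  refine Finset.sum_congr rfl fun nu _ => ?_
  rw [Pi.smul_apply, rosasSagan, rosasSaganSkew_apply, smul_eq_mul]
  ring
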